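/- For real $A<B$ and $\alpha,\beta>0$ let $\widetilde{\mathrm{Beta}}_{A,B}(\alpha,\beta)$ be the probability distribution on $\mathbb R$ with density $$\frac{(x-A)^{\alpha-1}(B-x)^{\beta-1}}{B(\alpha,\beta)\,(B-A)^{\alpha+\beta-1}}\quad\text{for }A<x<B,\qquad 0\text{ otherwise},$$ where $B(\alpha,\beta)=\Gamma(\alpha)\Gamma(\beta)/\Gamma(\alpha+\beta)$ is the beta function. Let $k\ge 1$ be an integer and $r_1,\dots,r_k>0$ real numbers. Let $U_1,\dots,U_k$ be independent random variables such that $U_j$ has the distribution $\widetilde{\mathrm{Beta}}_{A,B}(r_j+\tfrac12,\,r_j+\tfrac12)$, with the same interval $(A,B)$ for all $j$. Let $(X_1,\dots,X_{k-1})$ be a random vector, independent of $(U_1,\dots,U_k)$, having the Dirichlet distribution with parameters $(r_1,\dots,r_k)$, that is, with density $$\frac{\Gamma(r_1+\cdots+r_k)}{\Gamma(r_1)\cdots\Gamma(r_k)}\;\prod_{j=1}^{k-1}x_j^{r_j-1}\;\Bigl(1-\sum_{j=1}^{k-1}x_j\Bigr)^{r_k-1}$$ with respect to Lebesgue measure on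 $\mathbb R^{k-1}$ on the set where all $x_j>0$ and $\sum_{j=1}^{k-1} x_j<1$, and $0$ elsewhere (for $k=1$ the vector is empty). Then the random variable $$W=X_1U_1+\cdots+X_{k-1}U_{k-1}+\Bigl(1-\sum_{j=1}^{k-1}X_j\Bigr)U_k$$ has the distribution $\widetilde{\mathrm{Beta}}_{A,B}\Bigl(\sum_{j=1}^k r_j+\tfrac12,\ \sum_{j=1}^k r_j+\tfrac12\Bigr)$. Equivalently, define the non-commutative generalized convolution with parameters $(r_1,\dots,r_k)$ of probability measures $\mu_1,\dots,\mu_k$ on $\mathbb R$ to be the distribution of $W$ when the $U_j$ are independent with laws $\mu_j$ and $(X_1,\dots,X_{k-1})$ is Dirichlet$(r_1,\dots,r_k)$ and independent of them. Then the generalized convolution of the measures $\widetilde{\mathrm{Beta}}_{A,B}(r_j+\tfrac12,r_j+\tfrac12)$, $j=1,\dots,k$, is $\widetilde{\mathrm{Beta}}_{A,B}\bigl(\sum_j r_j+\tfrac12,\sum_j r_j+\tfrac12\bigr)$. -/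

import Mathlib

open MeasureTheory ProbabilityTheory

/-- Density of the beta distribution with parameters `α, β` on the interval `(A, B)`. Here
`ProbabilityTheory.beta α β = Γ(α) Γ(β) / Γ(α + β)` is the beta function. -/
noncomputable def betaIntervalPDFReal (A B α β x : ℝ) : ℝ :=
  if A < x ∧ x < B then
    1 / (ProbabilityTheory.beta α β * (B - A) ^ (α + β - 1)) *
      (x - A) ^ (α - 1) * (B - x) ^ (β - 1)
  else 0

/-- The beta distribution with parameters `α, β` on the interval `(A, B)`. -/
noncomputable def betaIntervalMeasure (A B α β : ℝ) : Measure ℝ :=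
  volume.withDensity (fun x => ENNReal.ofReal (betaIntervalPDFReal A B α β x))

/-- Density, with respect to Lebesgue measure on `ℝᵐ`, of the first `m` coordinates of a Dirichlet
vector with the `m + 1` parameters `a 0, …, a m`; the remaining coordinate is
`1 - ∑ j, x j`. -/
noncomputable def dirichletPDFReal {m : ℕ} (a : Fin (m + 1) → ℝ) (x : Fin m → ℝ) : ℝ :=
  if (∀ j, 0 < x j) ∧ ∑ j, x j < 1 then
    Real.Gamma (∑ j, a j) / (∏ j, Real.Gamma (a j)) *
      (∏ j : Fin m, x j ^ (a j.castSucc - 1)) * (1 - ∑ j, x j) ^ (a (Fin.last m) - 1)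
  else 0

/-- The Dirichlet distribution with parameters `a 0, …, a m`, as a measure on `ℝᵐ` (the law of
the first `m` coordinates). -/
noncomputable def dirichletMeasure {m : ℕ} (a : Fin (m + 1) → ℝ) : Measure (Fin m → ℝ) :=
  volume.withDensity (fun x => ENNReal.ofReal (dirichletPDFReal a x))

/-- The stochastic linear form `x₁ u₁ + ⋯ + x_{k-1} u_{k-1} + (1 - ∑ x_j) u_k`, with
`k = m + 1`. -/
def stochasticMix {m : ℕ} (x : Fin m → ℝ) (u : Fin (m + 1) → ℝ) : ℝ :=
  (∑ j : Fin m, x j * u j.castSucc) + (1 - ∑ j, x j) * u (Fin.last m)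

/-- The non-commutative generalized convolution with parameters `a` of the measures `μ j`: the law
of `stochasticMix X U`, where `U` has independent coordinates with laws `μ j`, and `X` is
independent of `U` and Dirichlet distributed with parameters `a`. -/
noncomputable def generalizedConvolution {m : ℕ} (a : Fin (m + 1) → ℝ)
    (μ : Fin (m + 1) → Measure ℝ) : Measure ℝ :=
  ((dirichletMeasure a).prod (Measure.pi μ)).map (fun p => stochasticMix p.1 p.2)

/-!
The distributions involved are carried by `[A, B]`, so they are determined by their moments, and an
affine change of variable reduces the computation to `(0, 1)`. For `V` with the symmetric beta
distribution with parameters `r + 1 / 2` on `(0, 1)`, put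
`c_r n = r (r + 1) ⋯ (r + n - 1) / n! * 𝔼[V ^ n]`.

Expanding `(∑ j, X j * V j) ^ n` by the multinomial theorem and inserting the mixed moments of the
Dirichlet vector (`integral_prod_fullWeights_pow`, a consequence of Dirichlet's integral) shows that
the sequence attached in the same way to `∑ j, X j * V j` and the parameter `∑ j, r j` is the Cauchy
product of the sequences `c_{r j}` (`integral_sum_fullWeights_mul_pow`). It remains to see
that the Cauchy product of `c_r` and `c_s` is `c_{r + s}`. The gamma function recurrence gives `c_r n = 4⁻ⁿ [zⁿ] C(z) ^ (2 r)`
(`gamma_div_mul_beta_div_eq_catalanPowerPoly`), with `C` the generating function of the Catalan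
numbers, and `C ^ s * C ^ t = C ^ (s + t)`; coefficientwise this is the Rothe–Hagen identity
`sum_antidiagonal_catalanPowerPoly`, which follows from `C = 1 + z * C ^ 2`.
-/

/-! ### Powers of the Catalan generating function -/

/-- The polynomial `s ↦ s / (s + 2 n) * (s + 2 n choose n)`, written without division by `s + 2 n`
as `s * ((s + n + 1) ⋯ (s + 2 n - 1)) / n!`. Its value at `s` is the coefficient of `z ^ n` in
`C(z) ^ s`, where `C` is the generating function of the Catalan numbers. -/
noncomputable def catalanPowerPoly : ℕ → Polynomial ℝ
  | 0 => 1
  | n + 1 => Polynomial.C (((n + 1).factorial : ℝ)⁻¹) * Polynomial.X *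
      (ascPochhammer ℝ n).comp (Polynomial.X + Polynomial.C ((n : ℝ) + 2))

lemma catalanPowerPoly_succ_eval (n : ℕ) (s : ℝ) :
    (catalanPowerPoly (n + 1)).eval s =
      s * (ascPochhammer ℝ n).eval (s + (n + 2)) / (n + 1).factorial := by
  simp [catalanPowerPoly]; ring

lemma ascPochhammer_succ_eval_left (n : ℕ) (s : ℝ) :
    (ascPochhammer ℝ (n + 1)).eval s = s * (ascPochhammer ℝ n).eval (s + 1) := by
  simp [ascPochhammer_succ_left]

/-- The coefficientwise form of `C ^ (s + 1) - C ^ s = z * C ^ (s + 2)`, that is, of the equation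
`C = 1 + z * C ^ 2`. -/
lemma catalanPowerPoly_eval_add_one (n : ℕ) (s : ℝ) :
    (catalanPowerPoly (n + 1)).eval (s + 1) =
      (catalanPowerPoly (n + 1)).eval s + (catalanPowerPoly n).eval (s + 2) := by
  cases n with
  | zero => simp [catalanPowerPoly]
  | succ k =>
    have hk : ((k + 1).factorial : ℝ) ≠ 0 := by positivity
    have hk' : ((k : ℝ) + 1 + 1) ≠ 0 := by positivity
    rw [catalanPowerPoly_succ_eval, catalanPowerPoly_succ_eval, catalanPowerPoly_succ_eval,
      ascPochhammer_succ_eval_left k (s + _), ascPochhammer_succ_eval, Nat.factorial_succ (k + 1)]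
    push_cast
    rw [show s + 1 + ((k : ℝ) + 1 + 2) = s + k + 4 by ring,
      show s + ((k : ℝ) + 1 + 2) + 1 = s + k + 4 by ring,
      show s + 2 + ((k : ℝ) + 2) = s + k + 4 by ring]
    field_simp
    ring

/-- The ratio of consecutive coefficients of `C ^ s`, to be compared with the ratio of consecutive
moments of a beta distribution. -/
lemma catalanPowerPoly_eval_succ_mul (n : ℕ) (s : ℝ) :
    (n + 1) * (s + n + 1) * (catalanPowerPoly (n + 1)).eval s =
      (s + 2 * n) * (s + 2 * n + 1) * (catalanPowerPoly n).eval s := by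
  cases n with
  | zero => simp [catalanPowerPoly]; ring
  | succ k =>
    have hk : ((k + 1).factorial : ℝ) ≠ 0 := by positivity
    have hk' : ((k : ℝ) + 1 + 1) ≠ 0 := by positivity
    have h := ascPochhammer_succ_eval_left (k + 1) (s + (k + 2))
    rw [ascPochhammer_succ_eval, ascPochhammer_succ_eval] at h
    rw [catalanPowerPoly_succ_eval, catalanPowerPoly_succ_eval, Nat.factorial_succ (k + 1)]
    push_cast at h ⊢
    rw [show s + ((k : ℝ) + 1 + 2) = s + (k + 2) + 1 by ring]
    field_simp
    linear_combination (-s) * h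

lemma Polynomial.eq_of_forall_natCast_eval_eq {p q : Polynomial ℝ}
    (h : ∀ n : ℕ, p.eval (n : ℝ) = q.eval (n : ℝ)) : p = q :=
  Polynomial.eq_of_infinite_eval_eq p q <|
    (Set.infinite_range_of_injective Nat.cast_injective).mono <| by
      rintro _ ⟨n, rfl⟩; exact h n

lemma catalanPowerPoly_eval_zero (n : ℕ) :
    (catalanPowerPoly n).eval 0 = if n = 0 then 1 else 0 := by
  cases n <;> simp [catalanPowerPoly]

/-- The coefficientwise form of `C ^ s * C ^ t = C ^ (s + t)` (a Rothe–Hagen identity). Both sides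
are polynomials in `s` that agree at `s = 0` and, by induction on `n`, have the same increments. -/
lemma sum_antidiagonal_catalanPowerPoly (n : ℕ) (s t : ℝ) :
    ∑ p ∈ Finset.HasAntidiagonal.antidiagonal n,
        (catalanPowerPoly p.1).eval s * (catalanPowerPoly p.2).eval t =
      (catalanPowerPoly n).eval (s + t) := by
  induction n generalizing s t with
  | zero => simp [catalanPowerPoly]
  | succ n ih =>
    have step (s : ℝ) :
        ∑ p ∈ Finset.HasAntidiagonal.antidiagonal (n + 1),
            (catalanPowerPoly p.1).eval (s + 1) * (catalanPowerPoly p.2).eval t =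
          ∑ p ∈ Finset.HasAntidiagonal.antidiagonal (n + 1),
              (catalanPowerPoly p.1).eval s * (catalanPowerPoly p.2).eval t +
            (catalanPowerPoly n).eval (s + 2 + t) := by
      rw [← ih, Finset.Nat.sum_antidiagonal_succ, Finset.Nat.sum_antidiagonal_succ]
      simp only [catalanPowerPoly_eval_add_one, add_mul, Finset.sum_add_distrib]
      simp [catalanPowerPoly]; ring
    have key : ∑ p ∈ Finset.HasAntidiagonal.antidiagonal (n + 1),
          catalanPowerPoly p.1 * Polynomial.C ((catalanPowerPoly p.2).eval t) =
        (catalanPowerPoly (n + 1)).comp (Polynomial.X + Polynomial.C t) := by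
      apply Polynomial.eq_of_forall_natCast_eval_eq
      intro k
      simp only [Polynomial.eval_finsetSum, Polynomial.eval_mul, Polynomial.eval_C,
        Polynomial.eval_comp, Polynomial.eval_add, Polynomial.eval_X]
      induction k with
      | zero =>
        rw [Finset.Nat.sum_antidiagonal_succ]
        simp [catalanPowerPoly_eval_zero]
      | succ k ihk =>
        push_cast
        rw [step, ihk, show (k : ℝ) + 1 + t = k + t + 1 by ring, catalanPowerPoly_eval_add_one,
          show (k : ℝ) + 2 + t = k + t + 2 by ring]
    simpa [Polynomial.eval_finsetSum] using congrArg (Polynomial.eval s) key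

/-- The coefficientwise form of `∏ i, C ^ s i = C ^ ∑ i, s i`. -/
lemma sum_piAntidiag_prod_catalanPowerPoly {ι : Type*} [DecidableEq ι] (S : Finset ι) (s : ι → ℝ)
    (n : ℕ) :
    ∑ k ∈ S.piAntidiag n, ∏ i ∈ S, (catalanPowerPoly (k i)).eval (s i) =
      (catalanPowerPoly n).eval (∑ i ∈ S, s i) := by
  induction S using Finset.cons_induction generalizing n with
  | empty => cases n <;> simp [catalanPowerPoly]
  | cons a S ha ih =>
    rw [Finset.piAntidiag_cons, Finset.sum_disjiUnion, Finset.sum_cons,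
      ← sum_antidiagonal_catalanPowerPoly]
    refine Finset.sum_congr rfl fun p _ => ?_
    rw [← ih, Finset.mul_sum, Finset.sum_map]
    refine Finset.sum_congr rfl fun k hk => ?_
    have hka : k a = 0 := by
      by_contra h
      exact ha ((Finset.mem_piAntidiag.1 hk).2 a h)
    rw [Finset.prod_cons]
    congr 1
    · simp [hka]
    · refine Finset.prod_congr rfl fun i hi => ?_
      have : i ≠ a := fun h => ha (h ▸ hi)
      simp [this]

/-! ### Densities and the beta distribution -/

lemma integral_withDensity_ofReal_eq_of_mul_eq {E : Type*} [MeasurableSpace E] {μ : Measure E}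
    {f f' g : E → ℝ} {c : ℝ} (hf : Measurable f) (hf0 : ∀ x, 0 ≤ f x)
    (hf' : Measurable f') (hf'0 : ∀ x, 0 ≤ f' x)
    (h1 : ∫⁻ x, ENNReal.ofReal (f' x) ∂μ = 1) (h : ∀ x, f x * g x = c * f' x) :
    ∫ x, g x ∂(μ.withDensity fun x => ENNReal.ofReal (f x)) = c := by
  rw [integral_withDensity_eq_integral_toReal_smul (by fun_prop) (by simp)]
  have h2 : ∫ x, f' x ∂μ = 1 := by
    rw [integral_eq_lintegral_of_nonneg_ae (.of_forall hf'0) hf'.aestronglyMeasurable, h1]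
    simp
  simp only [ENNReal.toReal_ofReal (hf0 _), smul_eq_mul, h]
  rw [integral_const_mul, h2, mul_one]

lemma betaPDFReal_nonneg {α β : ℝ} (hα : 0 < α) (hβ : 0 < β) (x : ℝ) : 0 ≤ betaPDFReal α β x := by
  by_cases hx : 0 < x ∧ x < 1
  · exact (betaPDFReal_pos hx.1 hx.2 hα hβ).le
  · simp [betaPDFReal, hx]

lemma integral_pow_betaMeasure {α β : ℝ} (hα : 0 < α) (hβ : 0 < β) (n : ℕ) :
    ∫ x, x ^ n ∂(betaMeasure α β) = beta (α + n) β / beta α β := by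
  have hα' : 0 < α + n := by positivity
  refine integral_withDensity_ofReal_eq_of_mul_eq (measurable_betaPDFReal α β)
    (betaPDFReal_nonneg hα hβ) (measurable_betaPDFReal (α + n) β) (betaPDFReal_nonneg hα' hβ)
    (lintegral_betaPDF_eq_one hα' hβ) fun x => ?_
  unfold betaPDFReal
  split_ifs with hx
  · have h1 := (beta_pos hα hβ).ne'
    have h2 := (beta_pos hα' hβ).ne'
    rw [show α + n - 1 = (α - 1) + n by ring, Real.rpow_add_natCast hx.1.ne']
    field_simp
  · simp

/-- The `n`-th moment of the symmetric beta distribution with parameters `r + 1 / 2`, multiplied by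
`r (r + 1) ⋯ (r + n - 1) / n!`, is the coefficient of `z ^ n` in `C(z / 4) ^ (2 r)`. -/
lemma gamma_div_mul_beta_div_eq_catalanPowerPoly {r : ℝ} (hr : 0 < r) (n : ℕ) :
    Real.Gamma (r + n) / Real.Gamma r / n.factorial *
        (beta (r + 1 / 2 + n) (r + 1 / 2) / beta (r + 1 / 2) (r + 1 / 2)) =
      (catalanPowerPoly n).eval (2 * r) / 4 ^ n := by
  have hr2 : 0 < r + 1 / 2 := by positivity
  have g0 := (Real.Gamma_pos_of_pos hr).ne'
  have g1 := (Real.Gamma_pos_of_pos hr2).ne'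
  have g2 := (Real.Gamma_pos_of_pos (add_pos hr2 hr2)).ne'
  induction n with
  | zero =>
    have := (beta_pos hr2 hr2).ne'
    simp only [Nat.cast_zero, add_zero, catalanPowerPoly, Nat.factorial_zero, Nat.cast_one]
    rw [div_self g0, div_self this]
    simp
  | succ n ih =>
    have e1 : Real.Gamma (r + (n + 1 : ℕ)) = (r + n) * Real.Gamma (r + n) := by
      rw [← Real.Gamma_add_one (by positivity)]; push_cast; ring_nf
    have e2 : Real.Gamma (r + 1 / 2 + (n + 1 : ℕ)) =
        (r + 1 / 2 + n) * Real.Gamma (r + 1 / 2 + n) := by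
      rw [← Real.Gamma_add_one (by positivity)]; push_cast; ring_nf
    have e3 : Real.Gamma (r + 1 / 2 + (n + 1 : ℕ) + (r + 1 / 2)) =
        (r + 1 / 2 + n + (r + 1 / 2)) * Real.Gamma (r + 1 / 2 + n + (r + 1 / 2)) := by
      rw [← Real.Gamma_add_one (by positivity)]; push_cast; ring_nf
    have g3 : Real.Gamma (r + 1 / 2 + n + (r + 1 / 2)) ≠ 0 :=
      (Real.Gamma_pos_of_pos (by positivity)).ne'
    have g4 : (n.factorial : ℝ) ≠ 0 := by positivity
    have g5 : (n : ℝ) + 1 ≠ 0 := by positivity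
    have g6 : r + 1 / 2 + n + (r + 1 / 2) ≠ 0 := by positivity
    have g7 : 2 * r + n + 1 ≠ 0 := by positivity
    have hA := catalanPowerPoly_eval_succ_mul n (2 * r)
    have hA' : (catalanPowerPoly (n + 1)).eval (2 * r) =
        (2 * r + 2 * n) * (2 * r + 2 * n + 1) / ((n + 1) * (2 * r + n + 1)) *
          (catalanPowerPoly n).eval (2 * r) := by
      field_simp; linear_combination hA
    rw [hA', pow_succ]
    have : (2 * r + 2 * n) * (2 * r + 2 * n + 1) / ((n + 1) * (2 * r + n + 1)) *
          (catalanPowerPoly n).eval (2 * r) / (4 ^ n * 4) =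
        (r + n) * (r + 1 / 2 + n) / ((n + 1) * (r + 1 / 2 + n + (r + 1 / 2))) *
          ((catalanPowerPoly n).eval (2 * r) / 4 ^ n) := by
      rw [show r + 1 / 2 + n + (r + 1 / 2) = 2 * r + n + 1 by ring]
      field_simp; ring
    rw [this, ← ih]
    unfold beta
    rw [e1, e2, e3, Nat.factorial_succ]
    push_cast
    -- After the recurrences the gamma values are mere atoms; `field_simp` must not rewrite inside.
    generalize r + 1 / 2 + ↑n + (r + 1 / 2) = q at *
    generalize Real.Gamma (r + 1 / 2 + n) = G
    generalize Real.Gamma (r + n) = G'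
    generalize Real.Gamma (r + 1 / 2 + (r + 1 / 2)) = G'' at *
    generalize Real.Gamma (r + 1 / 2) = G''' at *
    generalize r + 1 / 2 + (n : ℝ) = q'
    field_simp

lemma measurable_betaIntervalPDFReal (A B α β : ℝ) : Measurable (betaIntervalPDFReal A B α β) :=
  Measurable.ite measurableSet_Ioo (by fun_prop) (by fun_prop)

lemma sub_mul_betaIntervalPDFReal {A B : ℝ} (hAB : A < B) (α β x : ℝ) :
    (B - A) * betaIntervalPDFReal A B α β (A + (B - A) * x) = betaPDFReal α β x := by
  have h : 0 < B - A := sub_pos.2 hAB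
  have hiff : (A < A + (B - A) * x ∧ A + (B - A) * x < B) ↔ (0 < x ∧ x < 1) := by
    constructor
    · rintro ⟨h1, h2⟩
      exact ⟨pos_of_mul_pos_right (by linarith) h.le, by nlinarith⟩
    · rintro ⟨h1, h2⟩
      constructor <;> nlinarith
  unfold betaIntervalPDFReal betaPDFReal
  rw [if_congr hiff rfl rfl]
  split_ifs with hx
  · rw [show A + (B - A) * x - A = (B - A) * x by ring,
      show B - (A + (B - A) * x) = (B - A) * (1 - x) by ring,
      Real.mul_rpow h.le hx.1.le, Real.mul_rpow h.le (by linarith [hx.2]),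
      show α + β - 1 = 1 + (α - 1) + (β - 1) by ring, Real.rpow_add h, Real.rpow_add h,
      Real.rpow_one]
    have h1 := (Real.rpow_pos_of_pos h (α - 1)).ne'
    have h2 := (Real.rpow_pos_of_pos h (β - 1)).ne'
    field_simp
  · simp

lemma betaIntervalMeasure_eq_map {A B : ℝ} (hAB : A < B) (α β : ℝ) :
    betaIntervalMeasure A B α β = (betaMeasure α β).map (fun x => A + (B - A) * x) := by
  have h : 0 < B - A := sub_pos.2 hAB
  have hv : (volume : Measure ℝ) =
      ENNReal.ofReal (B - A) • (volume : Measure ℝ).map (fun x => A + (B - A) * x) := by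
    conv_lhs => rw [← map_add_left_eq_self (volume : Measure ℝ) A,
      ← Real.smul_map_volume_mul_left h.ne', abs_of_pos h, Measure.map_smul,
      Measure.map_map (by fun_prop) (by fun_prop)]
    rfl
  have hm := measurable_betaIntervalPDFReal A B α β
  refine Measure.ext_of_lintegral _ fun f hf => ?_
  rw [lintegral_map hf (by fun_prop), betaMeasure, betaIntervalMeasure,
    lintegral_withDensity_eq_lintegral_mul _ (by fun_prop) hf,
    lintegral_withDensity_eq_lintegral_mul _
      (by unfold betaPDF; fun_prop) (by fun_prop), hv, lintegral_smul_measure,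
    lintegral_map (by fun_prop) (by fun_prop), smul_eq_mul,
    ← lintegral_const_mul _ (by fun_prop), ← hv]
  refine lintegral_congr fun x => ?_
  simp only [Pi.mul_apply, betaPDF]
  rw [← sub_mul_betaIntervalPDFReal hAB, ENNReal.ofReal_mul h.le, mul_assoc]

lemma isProbabilityMeasure_betaIntervalMeasure {A B α β : ℝ} (hAB : A < B) (hα : 0 < α)
    (hβ : 0 < β) : IsProbabilityMeasure (betaIntervalMeasure A B α β) := by
  have := isProbabilityMeasureBeta hα hβ
  rw [betaIntervalMeasure_eq_map hAB]
  exact Measure.isProbabilityMeasure_map (by fun_prop)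

lemma lintegral_betaIntervalPDFReal {A B α β : ℝ} (hAB : A < B) (hα : 0 < α) (hβ : 0 < β) :
    ∫⁻ x, ENNReal.ofReal (betaIntervalPDFReal A B α β x) = 1 := by
  have := (isProbabilityMeasure_betaIntervalMeasure hAB hα hβ).measure_univ
  simpa [betaIntervalMeasure] using this

lemma ae_mem_Ioo_betaIntervalMeasure (A B α β : ℝ) :
    ∀ᵐ x ∂(betaIntervalMeasure A B α β), x ∈ Set.Ioo A B := by
  have hm := measurable_betaIntervalPDFReal A B α β
  rw [betaIntervalMeasure, ae_withDensity_iff (by fun_prop)]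
  refine .of_forall fun x hx => ?_
  by_contra h
  have h' : ¬ (A < x ∧ x < B) := h
  simp [betaIntervalPDFReal, h'] at hx

lemma integral_pow_betaIntervalMeasure {A B α β : ℝ} (hAB : A < B) (hα : 0 < α) (hβ : 0 < β)
    (n : ℕ) :
    ∫ x, ((x - A) / (B - A)) ^ n ∂(betaIntervalMeasure A B α β) = beta (α + n) β / beta α β := by
  have h : B - A ≠ 0 := (sub_pos.2 hAB).ne'
  rw [betaIntervalMeasure_eq_map hAB, integral_map (by fun_prop)
    (Measurable.aestronglyMeasurable (by fun_prop)), ← integral_pow_betaMeasure hα hβ]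
  simp [h]

/-! ### The Dirichlet distribution -/

/-- The unnormalized Dirichlet density on the simplex of all `x` with positive coordinates whose
sum is less than `t`. -/
noncomputable def dirichletKernel {m : ℕ} (a : Fin (m + 1) → ℝ) (t : ℝ) (x : Fin m → ℝ) : ℝ :=
  if (∀ j, 0 < x j) ∧ ∑ j, x j < t then
    (∏ j : Fin m, x j ^ (a j.castSucc - 1)) * (t - ∑ j, x j) ^ (a (Fin.last m) - 1)
  else 0

lemma dirichletKernel_nonneg {m : ℕ} (a : Fin (m + 1) → ℝ) (t : ℝ) (x : Fin m → ℝ) :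
    0 ≤ dirichletKernel a t x := by
  unfold dirichletKernel
  split_ifs with h
  · exact mul_nonneg (Finset.prod_nonneg fun j _ => Real.rpow_nonneg (h.1 j).le _)
      (Real.rpow_nonneg (by linarith [h.2]) _)
  · exact le_rfl

lemma measurable_dirichletKernel {m : ℕ} (a : Fin (m + 1) → ℝ) (t : ℝ) :
    Measurable (dirichletKernel a t) := by
  refine Measurable.ite ?_ (by fun_prop) (by fun_prop)
  rw [Set.ofPred_and]
  refine MeasurableSet.inter ?_ (measurableSet_lt (by fun_prop) (by fun_prop))
  rw [Set.ofPred_forall]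
  exact MeasurableSet.iInter fun j => measurableSet_lt (by fun_prop) (by fun_prop)

lemma dirichletKernel_cons {m : ℕ} (a : Fin (m + 2) → ℝ) (t x₀ : ℝ) (x : Fin m → ℝ) :
    dirichletKernel a t (Fin.cons x₀ x : Fin (m + 1) → ℝ) =
      (if 0 < x₀ ∧ x₀ < t then x₀ ^ (a 0 - 1) else 0) *
        dirichletKernel (Fin.tail a) (t - x₀) x := by
  have hiff : ((∀ j, 0 < (Fin.cons x₀ x : Fin (m + 1) → ℝ) j) ∧
      ∑ j, (Fin.cons x₀ x : Fin (m + 1) → ℝ) j < t) ↔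
      (0 < x₀ ∧ x₀ < t) ∧ ((∀ j, 0 < x j) ∧ ∑ j, x j < t - x₀) := by
    rw [Fin.forall_fin_succ, Fin.sum_univ_succ]
    simp only [Fin.cons_zero, Fin.cons_succ]
    constructor
    · rintro ⟨⟨h0, h⟩, hs⟩
      have := Finset.sum_nonneg fun j (_ : j ∈ Finset.univ) => (h j).le
      exact ⟨⟨h0, by linarith⟩, h, by linarith⟩
    · rintro ⟨⟨h0, -⟩, h, hs⟩
      exact ⟨⟨h0, h⟩, by linarith⟩
  unfold dirichletKernel
  rw [if_congr hiff rfl rfl, ite_and, Fin.prod_univ_succ, Fin.sum_univ_succ]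
  simp only [Fin.cons_zero, Fin.cons_succ, Fin.castSucc_zero, Fin.tail, Fin.succ_castSucc,
    Fin.succ_last]
  split_ifs <;> simp [mul_assoc, sub_sub]

/-- **Dirichlet's integral** over a scaled simplex. The induction integrates out all coordinates
but the first, which leaves a beta integral on `(0, t)`. -/
lemma lintegral_dirichletKernel {m : ℕ} (a : Fin (m + 1) → ℝ) (ha : ∀ j, 0 < a j) {t : ℝ}
    (ht : 0 < t) :
    ∫⁻ x, ENNReal.ofReal (dirichletKernel a t x) =
      ENNReal.ofReal ((∏ j, Real.Gamma (a j)) / Real.Gamma (∑ j, a j) * t ^ (∑ j, a j - 1)) := by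
  induction m generalizing t with
  | zero =>
    have := (Real.Gamma_pos_of_pos (ha 0)).ne'
    rw [volume_pi, Measure.pi_of_empty, lintegral_dirac]
    simp [dirichletKernel, ht, this]
  | succ m ih =>
    have hS : 0 < ∑ j : Fin (m + 1), a j.succ :=
      Finset.sum_pos (fun j _ => ha _) Finset.univ_nonempty
    have hGS := (Real.Gamma_pos_of_pos hS).ne'
    have hm := measurable_dirichletKernel a t
    rw [← ((volume_preserving_piFinSuccAbove (fun _ : Fin (m + 1) => ℝ) 0).symm _).lintegral_comp
      (by fun_prop), Measure.volume_eq_prod, lintegral_prod _ (by fun_prop)]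
    set c : ℝ := (∏ j, Real.Gamma (a j)) / Real.Gamma (∑ j, a j) * t ^ (∑ j, a j - 1) with hc
    have hc0 : 0 ≤ c := by
      have := Real.Gamma_pos_of_pos (Finset.sum_pos (fun j _ => ha j) Finset.univ_nonempty)
      have : 0 ≤ ∏ j, Real.Gamma (a j) :=
        Finset.prod_nonneg fun j _ => (Real.Gamma_pos_of_pos (ha j)).le
      positivity
    have key (x₀ : ℝ) :
        ∫⁻ x : Fin m → ℝ, ENNReal.ofReal (dirichletKernel a t
          ((MeasurableEquiv.piFinSuccAbove (fun _ : Fin (m + 1) => ℝ) 0).symm (x₀, x))) =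
        ENNReal.ofReal c *
          ENNReal.ofReal (betaIntervalPDFReal 0 t (a 0) (∑ j : Fin (m + 1), a j.succ) x₀) := by
      have hcons (x : Fin m → ℝ) :
          (MeasurableEquiv.piFinSuccAbove (fun _ : Fin (m + 1) => ℝ) 0).symm (x₀, x) =
            (Fin.cons x₀ x : Fin (m + 1) → ℝ) := by
        simp [MeasurableEquiv.piFinSuccAbove, Fin.insertNthEquiv]
      simp only [hcons, dirichletKernel_cons]
      unfold betaIntervalPDFReal
      split_ifs with hx
      · have hp : 0 ≤ x₀ ^ (a 0 - 1) := Real.rpow_nonneg hx.1.le _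
        simp only [ENNReal.ofReal_mul hp]
        have hm' := measurable_dirichletKernel (Fin.tail a) (t - x₀)
        rw [lintegral_const_mul _ (by fun_prop), ih (Fin.tail a) (fun j => ha _) (sub_pos.2 hx.2),
          ← ENNReal.ofReal_mul hp, ← ENNReal.ofReal_mul hc0]
        congr 1
        have hb : 0 < a 0 + ∑ j : Fin (m + 1), a j.succ := add_pos (ha 0) hS
        have hGb := (Real.Gamma_pos_of_pos hb).ne'
        have hG0 := (Real.Gamma_pos_of_pos (ha 0)).ne'
        have ht' := (Real.rpow_pos_of_pos ht (a 0 + ∑ j : Fin (m + 1), a j.succ - 1)).ne'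
        rw [hc, Fin.prod_univ_succ (f := fun j => Real.Gamma (a j)), Fin.sum_univ_succ (f := a)]
        simp only [Fin.tail, ProbabilityTheory.beta, sub_zero]
        field_simp
      · simp
    simp only [key]
    rw [lintegral_const_mul _ ((measurable_betaIntervalPDFReal _ _ _ _).ennreal_ofReal),
      lintegral_betaIntervalPDFReal ht (ha 0) hS, mul_one]

lemma dirichletPDFReal_eq {m : ℕ} (a : Fin (m + 1) → ℝ) (x : Fin m → ℝ) :
    dirichletPDFReal a x =
      Real.Gamma (∑ j, a j) / (∏ j, Real.Gamma (a j)) * dirichletKernel a 1 x := by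
  unfold dirichletPDFReal dirichletKernel
  split_ifs <;> simp [mul_assoc]

lemma measurable_dirichletPDFReal {m : ℕ} (a : Fin (m + 1) → ℝ) :
    Measurable (dirichletPDFReal a) := by
  have := measurable_dirichletKernel a 1
  simp only [funext (dirichletPDFReal_eq a)]
  fun_prop

lemma gamma_sum_div_prod_gamma_pos {m : ℕ} {a : Fin (m + 1) → ℝ} (ha : ∀ j, 0 < a j) :
    0 < Real.Gamma (∑ j, a j) / (∏ j, Real.Gamma (a j)) :=
  div_pos (Real.Gamma_pos_of_pos (Finset.sum_pos (fun j _ => ha j) Finset.univ_nonempty))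
    (Finset.prod_pos fun j _ => Real.Gamma_pos_of_pos (ha j))

lemma dirichletPDFReal_nonneg {m : ℕ} {a : Fin (m + 1) → ℝ} (ha : ∀ j, 0 < a j)
    (x : Fin m → ℝ) : 0 ≤ dirichletPDFReal a x := by
  rw [dirichletPDFReal_eq]
  exact mul_nonneg (gamma_sum_div_prod_gamma_pos ha).le (dirichletKernel_nonneg _ _ _)

lemma lintegral_dirichletPDFReal {m : ℕ} {a : Fin (m + 1) → ℝ} (ha : ∀ j, 0 < a j) :
    ∫⁻ x, ENNReal.ofReal (dirichletPDFReal a x) = 1 := by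
  have h := gamma_sum_div_prod_gamma_pos ha
  have hm := measurable_dirichletKernel a 1
  simp only [dirichletPDFReal_eq, ENNReal.ofReal_mul h.le]
  rw [lintegral_const_mul _ (by fun_prop), lintegral_dirichletKernel a ha one_pos,
    ← ENNReal.ofReal_mul h.le, Real.one_rpow, mul_one, ← inv_div (∏ j, _), inv_mul_cancel₀,
    ENNReal.ofReal_one]
  rw [← inv_div]
  exact inv_ne_zero h.ne'

lemma isProbabilityMeasure_dirichletMeasure {m : ℕ} {a : Fin (m + 1) → ℝ} (ha : ∀ j, 0 < a j) :
    IsProbabilityMeasure (dirichletMeasure a) where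
  measure_univ := by simp [dirichletMeasure, lintegral_dirichletPDFReal ha]

/-- The vector `x` completed by the last coordinate `1 - ∑ j, x j`, so that all `m + 1` weights sum
to `1`. -/
noncomputable def fullWeights {m : ℕ} (x : Fin m → ℝ) : Fin (m + 1) → ℝ :=
  Fin.snoc x (1 - ∑ j, x j)

@[simp] lemma fullWeights_castSucc {m : ℕ} (x : Fin m → ℝ) (j : Fin m) :
    fullWeights x j.castSucc = x j := by simp [fullWeights]

@[simp] lemma fullWeights_last {m : ℕ} (x : Fin m → ℝ) :
    fullWeights x (Fin.last m) = 1 - ∑ j, x j := by simp [fullWeights]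

lemma sum_fullWeights {m : ℕ} (x : Fin m → ℝ) : ∑ j, fullWeights x j = 1 := by
  simp [Fin.sum_univ_castSucc]

lemma measurable_fullWeights {m : ℕ} (j : Fin (m + 1)) :
    Measurable fun x : Fin m → ℝ => fullWeights x j := by
  induction j using Fin.lastCases with
  | last => simp only [fullWeights_last]; fun_prop
  | cast j => simp only [fullWeights_castSucc]; fun_prop

lemma ae_fullWeights_mem_Icc {m : ℕ} (a : Fin (m + 1) → ℝ) :
    ∀ᵐ x ∂(dirichletMeasure a), ∀ j, fullWeights x j ∈ Set.Icc (0 : ℝ) 1 := by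
  have hm := measurable_dirichletPDFReal a
  rw [dirichletMeasure, ae_withDensity_iff (by fun_prop)]
  refine .of_forall fun x hx => ?_
  have h : (∀ j, 0 < x j) ∧ ∑ j, x j < 1 := by
    by_contra h
    simp [dirichletPDFReal, h] at hx
  have h0 (j : Fin (m + 1)) : 0 ≤ fullWeights x j := by
    induction j using Fin.lastCases with
    | last => rw [fullWeights_last]; linarith [h.2]
    | cast j => rw [fullWeights_castSucc]; exact (h.1 j).le
  intro j
  refine ⟨h0 j, ?_⟩
  rw [← sum_fullWeights x]
  exact Finset.single_le_sum (fun i _ => h0 i) (Finset.mem_univ j)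

/-- The mixed moments of the Dirichlet distribution: multiplying a Dirichlet density by a monomial
gives a multiple of another Dirichlet density. -/
lemma integral_prod_fullWeights_pow {m : ℕ} {a : Fin (m + 1) → ℝ} (ha : ∀ j, 0 < a j)
    (k : Fin (m + 1) → ℕ) :
    ∫ x, ∏ j, fullWeights x j ^ k j ∂(dirichletMeasure a) =
      Real.Gamma (∑ j, a j) / Real.Gamma (∑ j, a j + ∑ j, (k j : ℝ)) *
        ∏ j, (Real.Gamma (a j + k j) / Real.Gamma (a j)) := by
  have hak (j) : 0 < a j + k j := add_pos_of_pos_of_nonneg (ha j) (Nat.cast_nonneg _)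
  refine integral_withDensity_ofReal_eq_of_mul_eq (f' := dirichletPDFReal fun j => a j + k j)
    (measurable_dirichletPDFReal a) (dirichletPDFReal_nonneg ha) (measurable_dirichletPDFReal _)
    (dirichletPDFReal_nonneg hak) (lintegral_dirichletPDFReal hak) fun x => ?_
  have h1 : ∏ j, Real.Gamma (a j) ≠ 0 :=
    (Finset.prod_pos fun j _ => Real.Gamma_pos_of_pos (ha j)).ne'
  have h2 : ∏ j, Real.Gamma (a j + k j) ≠ 0 :=
    (Finset.prod_pos fun j _ => Real.Gamma_pos_of_pos (hak j)).ne'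
  have h3 : Real.Gamma (∑ j, a j + ∑ j, (k j : ℝ)) ≠ 0 := by
    rw [← Finset.sum_add_distrib]
    exact (Real.Gamma_pos_of_pos
      (Finset.sum_pos (fun j _ => hak j) Finset.univ_nonempty)).ne'
  rw [dirichletPDFReal_eq, dirichletPDFReal_eq, Finset.prod_div_distrib, Finset.sum_add_distrib]
  have h4 : dirichletKernel a 1 x * ∏ j, fullWeights x j ^ k j =
      dirichletKernel (fun j => a j + k j) 1 x := by
    unfold dirichletKernel
    split_ifs with h
    · have h5 : ∏ j : Fin m, x j ^ (a j.castSucc + k j.castSucc - 1) =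
          ∏ j : Fin m, (x j ^ (a j.castSucc - 1) * x j ^ k j.castSucc) :=
        Finset.prod_congr rfl fun j _ => by
          rw [← Real.rpow_add_natCast (h.1 j).ne', sub_add_eq_add_sub]
      rw [h5, Finset.prod_mul_distrib, Fin.prod_univ_castSucc,
        add_sub_right_comm (a (Fin.last m)), Real.rpow_add_natCast (by linarith [h.2])]
      simp only [fullWeights_castSucc, fullWeights_last]
      ring
    · simp
  rw [mul_assoc, h4]
  field_simp

/-! ### Moment determinacy on a compact interval -/

lemma integrable_of_continuous_of_ae_mem_Icc {μ : Measure ℝ} [IsFiniteMeasure μ] {a b : ℝ}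
    (hμ : ∀ᵐ x ∂μ, x ∈ Set.Icc a b) {f : ℝ → ℝ} (hf : Continuous f) : Integrable f μ := by
  obtain ⟨C, hC⟩ := isCompact_Icc.exists_bound_of_continuousOn (s := Set.Icc a b) hf.continuousOn
  exact Integrable.of_bound hf.aestronglyMeasurable C (hμ.mono fun x hx => hC x hx)

/-- Two finite measures carried by a compact interval are equal if they have the same moments. -/
lemma ext_of_forall_integral_pow_eq {μ ν : Measure ℝ} [IsFiniteMeasure μ] [IsFiniteMeasure ν]
    {a b : ℝ} (hμ : ∀ᵐ x ∂μ, x ∈ Set.Icc a b) (hν : ∀ᵐ x ∂ν, x ∈ Set.Icc a b)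
    (h : ∀ n : ℕ, ∫ x, x ^ n ∂μ = ∫ x, x ^ n ∂ν) : μ = ν := by
  have hpoly (p : Polynomial ℝ) : ∫ x, p.eval x ∂μ = ∫ x, p.eval x ∂ν := by
    simp only [Polynomial.eval_eq_sum_range]
    rw [integral_finsetSum, integral_finsetSum]
    · simp only [integral_const_mul, h]
    · exact fun i _ => integrable_of_continuous_of_ae_mem_Icc hν (by fun_prop)
    · exact fun i _ => integrable_of_continuous_of_ae_mem_Icc hμ (by fun_prop)
  refine ext_of_forall_integral_eq_of_IsFiniteMeasure fun f => ?_
  have happrox {ρ : Measure ℝ} [IsFiniteMeasure ρ] (hρ : ∀ᵐ x ∂ρ, x ∈ Set.Icc a b)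
      {p : Polynomial ℝ} {ε : ℝ} (hp : ∀ x ∈ Set.Icc a b, |p.eval x - f x| < ε) :
      |∫ x, p.eval x ∂ρ - ∫ x, f x ∂ρ| ≤ ε * ρ.real Set.univ := by
    rw [← integral_sub (integrable_of_continuous_of_ae_mem_Icc hρ p.continuous)
      (integrable_of_continuous_of_ae_mem_Icc hρ f.continuous)]
    exact norm_integral_le_of_norm_le_const (f := fun x => p.eval x - f x)
      (hρ.mono fun x hx => (hp x hx).le)
  refine eq_of_forall_dist_le fun ε hε => ?_
  set M := μ.real Set.univ + ν.real Set.univ + 1 with hM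
  have hμ0 : 0 ≤ μ.real Set.univ := measureReal_nonneg
  have hν0 : 0 ≤ ν.real Set.univ := measureReal_nonneg
  have hM0 : 0 < M := by positivity
  obtain ⟨p, hp⟩ := exists_polynomial_near_of_continuousOn a b f f.continuous.continuousOn
    (ε / M) (by positivity)
  have h1 := abs_le.1 (happrox hμ hp)
  have h2 := abs_le.1 (happrox hν hp)
  rw [hpoly p] at h1
  have h3 : ε / M * (μ.real Set.univ + ν.real Set.univ) ≤ ε := by
    rw [div_mul_eq_mul_div, div_le_iff₀ hM0]
    exact mul_le_mul_of_nonneg_left (by linarith) hε.le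
  rw [Real.dist_eq, abs_le]
  constructor <;> linarith

/-! ### Moments of the stochastic mixture -/

lemma stochasticMix_eq_sum {m : ℕ} (x : Fin m → ℝ) (u : Fin (m + 1) → ℝ) :
    stochasticMix x u = ∑ j, fullWeights x j * u j := by
  simp [stochasticMix, Fin.sum_univ_castSucc]

lemma measurable_stochasticMix {m : ℕ} :
    Measurable fun p : (Fin m → ℝ) × (Fin (m + 1) → ℝ) => stochasticMix p.1 p.2 := by
  unfold stochasticMix
  fun_prop

lemma stochasticMix_affine {m : ℕ} (x : Fin m → ℝ) (u : Fin (m + 1) → ℝ) (c d : ℝ) :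
    (stochasticMix x u - c) / d = ∑ j, fullWeights x j * ((u j - c) / d) := by
  simp only [stochasticMix_eq_sum, mul_div_assoc', mul_sub, ← Finset.sum_div,
    Finset.sum_sub_distrib, ← Finset.sum_mul, sum_fullWeights, one_mul]

/-- The moments of `∑ j, X j * U j`, for a Dirichlet vector `X` independent of the independent
bounded variables `U j`, in terms of the moments `M j` of the `U j`. -/
lemma integral_sum_fullWeights_mul_pow {m : ℕ} {r : Fin (m + 1) → ℝ} (hr : ∀ j, 0 < r j)
    (μ : Fin (m + 1) → Measure ℝ) [∀ j, IsProbabilityMeasure (μ j)] {φ : ℝ → ℝ}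
    (hφ : Measurable φ) (hμ : ∀ j, ∀ᵐ x ∂(μ j), φ x ∈ Set.Icc (0 : ℝ) 1) (n : ℕ) :
    ∫ p, (∑ j, fullWeights p.1 j * φ (p.2 j)) ^ n ∂((dirichletMeasure r).prod (Measure.pi μ)) =
      n.factorial * Real.Gamma (∑ j, r j) / Real.Gamma (∑ j, r j + n) *
        ∑ k ∈ Finset.univ.piAntidiag n, ∏ j,
          (Real.Gamma (r j + k j) / Real.Gamma (r j) / (k j).factorial *
            ∫ x, φ x ^ k j ∂(μ j)) := by
  have := isProbabilityMeasure_dirichletMeasure hr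
  have hX (k : Fin (m + 1) → ℕ) :
      Integrable (fun x : Fin m → ℝ => ∏ j, fullWeights x j ^ k j) (dirichletMeasure r) := by
    refine Integrable.of_mem_Icc 0 1 (Measurable.aemeasurable ?_) ?_
    · exact Finset.measurable_prod _ fun j _ => (measurable_fullWeights j).pow_const _
    · filter_upwards [ae_fullWeights_mem_Icc r] with x hx
      exact ⟨Finset.prod_nonneg fun j _ => pow_nonneg (hx j).1 _,
        Finset.prod_le_one (fun j _ => pow_nonneg (hx j).1 _)
          fun j _ => pow_le_one₀ (hx j).1 (hx j).2⟩
  have hU (k : Fin (m + 1) → ℕ) :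
      Integrable (fun u : Fin (m + 1) → ℝ => ∏ j, φ (u j) ^ k j) (Measure.pi μ) := by
    refine Integrable.fintype_prod_dep (f := fun j x => φ x ^ k j) fun j => ?_
    refine Integrable.of_mem_Icc 0 1 (by fun_prop) ?_
    filter_upwards [hμ j] with x hx
    exact ⟨pow_nonneg hx.1 _, pow_le_one₀ hx.1 hx.2⟩
  simp only [Finset.sum_pow_eq_sum_piAntidiag, mul_pow, Finset.prod_mul_distrib]
  rw [integral_finsetSum _ fun k _ => ((hX k).mul_prod (hU k)).const_mul _, Finset.mul_sum]
  refine Finset.sum_congr rfl fun k hk => ?_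
  have hkn : ∑ j, k j = n := (Finset.mem_piAntidiag.1 hk).1
  rw [integral_const_mul, integral_prod_mul (fun x : Fin m → ℝ => ∏ j, fullWeights x j ^ k j)
      (fun u : Fin (m + 1) → ℝ => ∏ j, φ (u j) ^ k j), integral_prod_fullWeights_pow hr,
    integral_fintype_prod_eq_prod (fun j x => φ x ^ k j)]
  have hmult : (∏ j, ((k j).factorial : ℝ)) * (Nat.multinomial Finset.univ k : ℝ) =
      n.factorial := by
    rw [← hkn]
    exact_mod_cast Nat.multinomial_spec Finset.univ k
  have hfac : ∏ j, ((k j).factorial : ℝ) ≠ 0 :=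
    Finset.prod_ne_zero_iff.2 fun j _ => by positivity
  rw [← Nat.cast_sum, hkn, ← hmult]
  simp only [Finset.prod_div_distrib]
  field_simp

lemma generalizedConvolution_betaIntervalMeasure {m : ℕ} {A B : ℝ} (hAB : A < B)
    {r : Fin (m + 1) → ℝ} (hr : ∀ j, 0 < r j) :
    generalizedConvolution r (fun j => betaIntervalMeasure A B (r j + 1 / 2) (r j + 1 / 2)) =
      betaIntervalMeasure A B ((∑ j, r j) + 1 / 2) ((∑ j, r j) + 1 / 2) := by
  have hBA : 0 < B - A := sub_pos.2 hAB
  have hr2 (j) : 0 < r j + 1 / 2 := add_pos (hr j) (by norm_num)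
  have hR : 0 < ∑ j, r j := Finset.sum_pos (fun j _ => hr j) Finset.univ_nonempty
  have hR2 : 0 < ∑ j, r j + 1 / 2 := by positivity
  have hD := isProbabilityMeasure_dirichletMeasure hr
  have hμ (j) : IsProbabilityMeasure (betaIntervalMeasure A B (r j + 1 / 2) (r j + 1 / 2)) :=
    isProbabilityMeasure_betaIntervalMeasure hAB (hr2 j) (hr2 j)
  have hν := isProbabilityMeasure_betaIntervalMeasure hAB hR2 hR2
  have hmix := measurable_stochasticMix (m := m)
  set μ := fun j => betaIntervalMeasure A B (r j + 1 / 2) (r j + 1 / 2)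
  set φ : ℝ → ℝ := fun x => (x - A) / (B - A) with hφdef
  have hφ : Measurable φ := by fun_prop
  have hφmem {x : ℝ} (hx : x ∈ Set.Ioo A B) : φ x ∈ Set.Icc (0 : ℝ) 1 :=
    ⟨div_nonneg (by linarith [hx.1]) hBA.le, (div_le_one hBA).2 (by linarith [hx.2])⟩
  have hφμ (j) : ∀ᵐ x ∂(μ j), φ x ∈ Set.Icc (0 : ℝ) 1 :=
    (ae_mem_Ioo_betaIntervalMeasure _ _ _ _).mono fun x hx => hφmem hx
  have hφmix (p : (Fin m → ℝ) × (Fin (m + 1) → ℝ)) :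
      φ (stochasticMix p.1 p.2) = ∑ j, fullWeights p.1 j * φ (p.2 j) :=
    stochasticMix_affine _ _ _ _
  -- Comparing the pushforwards under `φ` suffices, since `φ` is invertible.
  suffices h : (generalizedConvolution r μ).map φ =
      (betaIntervalMeasure A B ((∑ j, r j) + 1 / 2) ((∑ j, r j) + 1 / 2)).map φ by
    have hinv (ρ : Measure ℝ) : (ρ.map φ).map (fun y => A + (B - A) * y) = ρ := by
      rw [Measure.map_map (by fun_prop) hφ]
      convert Measure.map_id
      ext x
      simp only [hφdef, Function.comp_apply, id]
      field_simp
      ring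
    rw [← hinv (generalizedConvolution r μ), h, hinv]
  have hG : IsProbabilityMeasure (generalizedConvolution r μ) :=
    Measure.isProbabilityMeasure_map hmix.aemeasurable
  have hG' := Measure.isProbabilityMeasure_map (μ := generalizedConvolution r μ) hφ.aemeasurable
  have hν' := Measure.isProbabilityMeasure_map
    (μ := betaIntervalMeasure A B ((∑ j, r j) + 1 / 2) ((∑ j, r j) + 1 / 2)) hφ.aemeasurable
  refine ext_of_forall_integral_pow_eq (a := 0) (b := 1) ?_ ?_ fun n => ?_
  · rw [ae_map_iff (p := (· ∈ Set.Icc (0 : ℝ) 1)) hφ.aemeasurable measurableSet_Icc,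
      generalizedConvolution, ae_map_iff hmix.aemeasurable (hφ measurableSet_Icc)]
    have hu : ∀ᵐ u ∂(Measure.pi μ), ∀ j, φ (u j) ∈ Set.Icc (0 : ℝ) 1 :=
      ae_all_iff.2 fun j => (measurePreserving_eval μ j).quasiMeasurePreserving.ae (hφμ j)
    filter_upwards [Measure.quasiMeasurePreserving_fst.ae (ae_fullWeights_mem_Icc r),
      Measure.quasiMeasurePreserving_snd.ae hu] with p hp1 hp2
    rw [hφmix]
    refine ⟨Finset.sum_nonneg fun j _ => mul_nonneg (hp1 j).1 (hp2 j).1, ?_⟩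
    rw [← sum_fullWeights p.1]
    exact Finset.sum_le_sum fun j _ => mul_le_of_le_one_right (hp1 j).1 (hp2 j).2
  · rw [ae_map_iff (p := (· ∈ Set.Icc (0 : ℝ) 1)) hφ.aemeasurable measurableSet_Icc]
    exact (ae_mem_Ioo_betaIntervalMeasure _ _ _ _).mono fun x hx => hφmem hx
  · rw [integral_map hφ.aemeasurable (by fun_prop), integral_map hφ.aemeasurable (by fun_prop),
      integral_pow_betaIntervalMeasure hAB hR2 hR2, generalizedConvolution,
      integral_map hmix.aemeasurable (Measurable.aestronglyMeasurable (by fun_prop))]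
    simp only [hφmix]
    rw [integral_sum_fullWeights_mul_pow hr μ hφ hφμ]
    have hk (k : Fin (m + 1) → ℕ) (hk : k ∈ Finset.univ.piAntidiag n) :
        ∏ j, (Real.Gamma (r j + k j) / Real.Gamma (r j) / (k j).factorial *
            ∫ x, φ x ^ k j ∂(μ j)) =
          (∏ j, (catalanPowerPoly (k j)).eval (2 * r j)) / 4 ^ n := by
      rw [← (Finset.mem_piAntidiag.1 hk).1, ← Finset.prod_pow_eq_pow_sum,
        ← Finset.prod_div_distrib]
      refine Finset.prod_congr rfl fun j _ => ?_
      rw [integral_pow_betaIntervalMeasure hAB (hr2 j) (hr2 j),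
        gamma_div_mul_beta_div_eq_catalanPowerPoly (hr j)]
    rw [Finset.sum_congr rfl hk, ← Finset.sum_div, sum_piAntidiag_prod_catalanPowerPoly,
      ← Finset.mul_sum, ← gamma_div_mul_beta_div_eq_catalanPowerPoly hR]
    have h1 := (Real.Gamma_pos_of_pos hR).ne'
    have h2 := (Real.Gamma_pos_of_pos (show 0 < ∑ j, r j + n by positivity)).ne'
    have h3 : (n.factorial : ℝ) ≠ 0 := by positivity
    field_simp

theorem theorem3 {m : ℕ} (A B : ℝ) (hAB : A < B)
    (r : Fin (m + 1) → ℝ) (hr : ∀ j, 0 < r j)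
    {Ω : Type*} [MeasurableSpace Ω] (P : Measure Ω) [IsProbabilityMeasure P]
    (U : Fin (m + 1) → Ω → ℝ) (X : Fin m → Ω → ℝ)
    (hU : ∀ j, HasLaw (U j) (betaIntervalMeasure A B (r j + 1 / 2) (r j + 1 / 2)) P)
    (hX : HasLaw (fun ω j => X j ω) (dirichletMeasure r) P)
    (hUindep : iIndepFun U P)
    (hXU : IndepFun (fun ω j => X j ω) (fun ω j => U j ω) P) :
    HasLaw
        (fun ω => (∑ j : Fin m, X j ω * U j.castSucc ω) + (1 - ∑ j, X j ω) * U (Fin.last m) ω)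
        (betaIntervalMeasure A B ((∑ j, r j) + 1 / 2) ((∑ j, r j) + 1 / 2)) P ∧
      generalizedConvolution r
          (fun j => betaIntervalMeasure A B (r j + 1 / 2) (r j + 1 / 2)) =
        betaIntervalMeasure A B ((∑ j, r j) + 1 / 2) ((∑ j, r j) + 1 / 2) := by

  have hconv := generalizedConvolution_betaIntervalMeasure hAB hr
  refine ⟨?_, hconv⟩
  have hjoint := hXU.hasLaw_prod hX (hUindep.hasLaw_pi hU)
  rw [← hconv]
  exact HasLaw.comp (Y := fun p : (Fin m → ℝ) × (Fin (m + 1) → ℝ) => stochasticMix p.1 p.2)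
    ⟨measurable_stochasticMix.aemeasurable, rfl⟩ hjoint
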